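/- Let $K$ be an infinite field, $n\ge 1$, and $P=K[x_1,\dots,x_n]$ with the standard grading; $P_1$ is the space of linear forms. Definitions. A monomial ideal $I\subseteq P$ (one spanned as a $K$-vector space by power products) is *strongly stable* if for every power product $t\in I$, every $x_j\mid t$ and every $i\le j$ one has $x_i\,t/x_j\in I$. A *distraction matrix* is a family $\mathcal L=(L_{ij})_{1\le i\le n,\ j\ge 1}$ of linear forms in $P_1$ such that $\langle L_{1j_1},\dots,L_{nj_n}\rangle=P_1$ for all $j_1,\dots,j_n$, and such that for some $N$ one has $L_{ij}=L_{iN}$ for all $i$ and all $j>N$. Its distraction operator $D_{\mathcal L}:P\to P$ is the $K$-linear map with $D_{\mathcal L}(x_1^{\alpha_1}\cdots x_n^{\alpha_n})=\prod_{i=1}^n\prod_{j=1}^{\alpha_i}L_{ij}$; the image $D_{\mathcal L}(J)$ of a monomial ideal $J$ is an ideal. For a homogeneous ideal $Q$, $\mathrm{gin}_{\mathrm{drl}}(Q)$ is the generic initial ideal with respect to the degree reverse lexicographic ordering with $x_1>\dots>x_n$, i.e. the ideal $M$ such that $\mathrm{in}_{\mathrm{drl}}(g(Q))=M$ for all $g$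 in a non-empty Zariski-open subset of $\mathrm{GL}(n,K)$, acting by $x_j\mapsto\sum_i g_{ij}x_i$. Statement. Let $I\subseteq P$ be a strongly stable monomial ideal, and assume that the greatest common divisor of the minimal generators (minimal power products) of $I$ is $x_1^a$, with $a\ge 0$. Then there is an ideal $J$ with $I=x_1^aJ$, and for this $J$: (a) the ideal $J$ is a strongly stable monomial ideal; (b) for every non-zero form $F\in P$ of degree $a$ and every distraction matrix $\mathcal L$, $$\mathrm{gin}_{\mathrm{drl}}\bigl(F\cdot D_{\mathcal L}(J)\bigr)=I=x_1^a\,J .$$ -/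

import Mathlib

open MvPolynomial
open scoped MonomialOrder

/-! ### The degree reverse lexicographic ordering -/

/-- A copy of the monoid of power products in `n` indeterminates (exponent vectors), to be ordered
by the degree reverse lexicographic ordering. -/
def DRL (n : ℕ) : Type := Fin n →₀ ℕ

noncomputable instance DRL.instAddCommMonoid (n : ℕ) : AddCommMonoid (DRL n) :=
  inferInstanceAs (AddCommMonoid (Fin n →₀ ℕ))

/-- The exponent vector of a power product. -/
def DRL.exp {n : ℕ} (a : DRL n) : Fin n →₀ ℕ := a

/-- The sort key of the ordering: first the degree is compared, then, with the indeterminates read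
from the last one to the first one, the exponents are compared lexicographically, and the
result of the latter comparison is reversed. -/
noncomputable def DRL.key {n : ℕ} (a : Fin n →₀ ℕ) : ℕ ×ₗ (Lex (Fin n → ℕ))ᵒᵈ :=
  toLex (a.degree, OrderDual.toDual (toLex (fun i : Fin n => a (Fin.rev i))))

theorem DRL.key_injective {n : ℕ} : Function.Injective (DRL.key (n := n)) := by
  intro a b h
  have h1 : (fun i : Fin n => a (Fin.rev i)) = fun i : Fin n => b (Fin.rev i) :=
    congrArg (fun z : ℕ ×ₗ (Lex (Fin n → ℕ))ᵒᵈ => ofLex (OrderDual.ofDual (ofLex z).2)) h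
  ext i
  simpa using congrFun h1 (Fin.rev i)

noncomputable instance DRL.instLinearOrder (n : ℕ) : LinearOrder (DRL n) :=
  LinearOrder.lift' (fun a : DRL n => DRL.key a.exp) DRL.key_injective

theorem DRL.lt_iff {n : ℕ} (a b : DRL n) : a < b ↔
    Finsupp.degree a.exp < Finsupp.degree b.exp ∨
    (Finsupp.degree a.exp = Finsupp.degree b.exp ∧
      ∃ i : Fin n, b.exp i < a.exp i ∧
        ∀ j : Fin n, i < j → a.exp j = b.exp j) := by
  change DRL.key a.exp < DRL.key b.exp ↔ _
  unfold DRL.key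
  rw [Prod.Lex.toLex_lt_toLex]
  refine or_congr Iff.rfl (and_congr Iff.rfl ?_)
  rw [OrderDual.toDual_lt_toDual]
  constructor
  · rintro ⟨i, hi, hlt⟩
    refine ⟨Fin.rev i, hlt, fun j hj => ?_⟩
    have := hi (Fin.rev j) (Fin.rev_lt_iff.2 hj)
    simpa using this.symm
  · rintro ⟨i, hlt, hi⟩
    refine ⟨Fin.rev i, fun j hj => ?_, by simpa using hlt⟩
    have := hi (Fin.rev j) (Fin.lt_rev_iff.2 hj)
    simpa using this.symm

theorem DRL.add_lt_add_left' {n : ℕ} (a b c : DRL n) (h : a < b) : c + a < c + b := by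
  rw [DRL.lt_iff] at h ⊢
  have hd : ∀ x : DRL n, Finsupp.degree (c + x).exp =
      Finsupp.degree c.exp + Finsupp.degree x.exp :=
    fun x => map_add Finsupp.degree c.exp x.exp
  have hv : ∀ (x : DRL n) (i : Fin n), (c + x).exp i =
      c.exp i + x.exp i := fun x i => rfl
  rw [hd, hd]
  rcases h with h | ⟨h, i, hi, hj⟩
  · left; omega
  · refine Or.inr ⟨by omega, i, ?_, fun j hij => ?_⟩
    · rw [hv, hv]; omega
    · rw [hv, hv, hj j hij]

instance DRL.instIsOrderedAddMonoid (n : ℕ) : IsOrderedAddMonoid (DRL n) where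
  add_le_add_left a b h c := by
    rcases h.lt_or_eq with h | rfl
    · rw [add_comm a c, add_comm b c]
      exact (DRL.add_lt_add_left' a b c h).le
    · exact le_rfl

theorem DRL.mono {n : ℕ} (a b : Fin n →₀ ℕ) (h : a ≤ b) :
    (show DRL n from a) ≤ (show DRL n from b) := by
  rcases h.eq_or_lt with rfl | hlt
  · exact le_rfl
  · refine le_of_lt ((DRL.lt_iff _ _).2 (Or.inl ?_))
    obtain ⟨c, rfl⟩ := exists_add_of_le h
    have hc : c ≠ 0 := by
      rintro rfl
      simp at hlt
    have : Finsupp.degree c ≠ 0 := fun h0 => hc ((Finsupp.degree_eq_zero_iff c).1 h0)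
    change Finsupp.degree a < Finsupp.degree (a + c)
    rw [map_add]
    omega

instance DRL.instWellFoundedLT (n : ℕ) : WellFoundedLT (DRL n) := by
  have hw : WellQuasiOrderedLE (Fin n → ℕ) := inferInstance
  refine ⟨RelEmbedding.wellFounded_iff_isEmpty.2 ⟨fun f => ?_⟩⟩
  obtain ⟨i, j, hij, hle⟩ :=
    hw.wqo (fun k => (⇑(f k).exp : Fin n → ℕ))
  have h1 : f j < f i := f.map_rel_iff.2 hij
  exact absurd (DRL.mono _ _ hle) (not_le.2 h1)

/-- The degree reverse lexicographic ordering `DegRevLex` on the power products in `x₁, …, xₙ`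
(the indeterminate `xₖ` is `X (k - 1)`, so that `X 0 > X 1 > ⋯`). -/
noncomputable def degRevLex (n : ℕ) : MonomialOrder (Fin n) where
  syn := DRL n
  toSyn := { toFun := fun a => a, invFun := fun a => a, left_inv := fun _ => rfl,
             right_inv := fun _ => rfl, map_add' := fun _ _ => rfl }
  toSyn_monotone a b h := DRL.mono a b h

theorem degRevLex_lt_iff {n : ℕ} (a b : Fin n →₀ ℕ) : a ≺[degRevLex n] b ↔
    a.degree < b.degree ∨
    (a.degree = b.degree ∧ ∃ i : Fin n, b i < a i ∧ ∀ j : Fin n, i < j → a j = b j) :=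
  DRL.lt_iff (show DRL n from a) (show DRL n from b)

/-! ### Initial ideals and generic initial ideals -/

/-- The initial ideal of `I`: it is generated by the leading power products of the non-zero
elements of `I`. -/
noncomputable def initialIdeal {n : ℕ} {K : Type*} [Field K] (m : MonomialOrder (Fin n))
    (I : Ideal (MvPolynomial (Fin n) K)) : Ideal (MvPolynomial (Fin n) K) :=
  Ideal.span {t | ∃ f ∈ I, f ≠ 0 ∧ t = monomial (m.degree f) 1}

/-- The linear change of coordinates given by a matrix `g`: `x_j ↦ ∑ i, g i j * x_i`. -/
noncomputable def coordChange {n : ℕ} {K : Type*} [Field K] (g : Matrix (Fin n) (Fin n) K) :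
    MvPolynomial (Fin n) K →ₐ[K] MvPolynomial (Fin n) K :=
  aeval (fun j => ∑ i, C (g i j) * X i)

/-- `M` is the generic initial ideal of `I`: one has `in (g I) = M` for a generic `g ∈ GL(n, K)`,
that is, for all invertible `g` outside the zero set of some non-zero polynomial in the
entries of the matrix. -/
def IsGin {n : ℕ} {K : Type*} [Field K] (m : MonomialOrder (Fin n))
    (I M : Ideal (MvPolynomial (Fin n) K)) : Prop :=
  ∃ p : MvPolynomial (Fin n × Fin n) K, p ≠ 0 ∧
    ∀ g : GL (Fin n) K, eval (fun ij => g.1 ij.1 ij.2) p ≠ 0 →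
      initialIdeal m (I.map (coordChange g.1)) = M

/-- Over an infinite field, there is at most one generic initial ideal. -/
theorem IsGin.unique {n : ℕ} {K : Type*} [Field K] [Infinite K] {m : MonomialOrder (Fin n)}
    {I M M' : Ideal (MvPolynomial (Fin n) K)} (h : IsGin m I M) (h' : IsGin m I M') : M = M' := by
  obtain ⟨p, hp, h⟩ := h
  obtain ⟨q, hq, h'⟩ := h'
  have hd : Matrix.det (Matrix.mvPolynomialX (Fin n) (Fin n) K) ≠ 0 :=
    Matrix.det_mvPolynomialX_ne_zero (Fin n) K
  have hne : p * q * Matrix.det (Matrix.mvPolynomialX (Fin n) (Fin n) K) ≠ 0 :=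
    mul_ne_zero (mul_ne_zero hp hq) hd
  obtain ⟨x, hx⟩ : ∃ x : Fin n × Fin n → K,
      eval x (p * q * Matrix.det (Matrix.mvPolynomialX (Fin n) (Fin n) K)) ≠ 0 := by
    by_contra hcon
    push Not at hcon
    exact hne (MvPolynomial.funext fun x => by simpa using hcon x)
  rw [map_mul, map_mul] at hx
  have hx1 : eval x p ≠ 0 := left_ne_zero_of_mul (left_ne_zero_of_mul hx)
  have hx2 : eval x q ≠ 0 := right_ne_zero_of_mul (left_ne_zero_of_mul hx)
  have hx3 : (Matrix.of fun i j => x (i, j)).det ≠ 0 := by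
    have := right_ne_zero_of_mul hx
    rw [RingHom.map_det] at this
    convert this using 2
    ext i j
    simp [Matrix.mvPolynomialX]
  let g : GL (Fin n) K := Matrix.GeneralLinearGroup.mkOfDetNeZero _ hx3
  rw [← h g hx1, ← h' g hx2]

/-! ### Monomial ideals and strongly stable ideals -/

/-- A monomial ideal: as a vector space it is spanned by power products. -/
def IsMonomialIdeal {n : ℕ} {K : Type*} [Field K] (I : Ideal (MvPolynomial (Fin n) K)) : Prop :=
  ∃ S : Set (Fin n →₀ ℕ), I.restrictScalars K =
    Submodule.span K ((fun t => (monomial t 1 : MvPolynomial (Fin n) K)) '' S)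

/-- A strongly stable ideal: a monomial ideal such that for each power product `t` in it, each `x_j`
dividing `t` and each `i ≤ j`, the power product `x_i * (t / x_j)` is in it, too. -/
def IsStronglyStable {n : ℕ} {K : Type*} [Field K] (I : Ideal (MvPolynomial (Fin n) K)) : Prop :=
  IsMonomialIdeal I ∧
    ∀ t : Fin n →₀ ℕ, (monomial t 1 : MvPolynomial (Fin n) K) ∈ I →
      ∀ i j : Fin n, 0 < t j → i ≤ j →
        (monomial (Finsupp.single i 1 + (t - Finsupp.single j 1)) 1 : MvPolynomial (Fin n) K) ∈ I

/-- The minimal generators of a monomial ideal: the power products in it that are minimal with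
respect to divisibility (divisibility of power products is `≤` of exponent vectors). -/
def minimalGenerators {n : ℕ} {K : Type*} [Field K] (I : Ideal (MvPolynomial (Fin n) K)) :
    Set (MvPolynomial (Fin n) K) :=
  (fun t => (monomial t 1 : MvPolynomial (Fin n) K)) ''
    {t | Minimal (fun s => (monomial s 1 : MvPolynomial (Fin n) K) ∈ I) t}

/-- `d` is a greatest common divisor of the set `S`: its divisors are the common divisors
of the elements of `S`. -/
def IsGCDOf {R : Type*} [CommRing R] (d : R) (S : Set R) : Prop :=
  ∀ e : R, e ∣ d ↔ ∀ s ∈ S, e ∣ s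

/-! ### Distractions -/

/-- A distraction matrix: a matrix of linear forms with rows indexed by the indeterminates and
infinitely many columns (the first column is column `0`), such that any choice of one entry
in each row gives a generating system of the space of linear forms, and such that the columns
are eventually constant. -/
structure IsDistractionMatrix {n : ℕ} {K : Type*} [Field K]
    (L : Fin n → ℕ → MvPolynomial (Fin n) K) : Prop where
  linear : ∀ i j, (L i j).IsHomogeneous 1
  span_eq : ∀ c : Fin n → ℕ,
    Submodule.span K (Set.range fun i => L i (c i)) = homogeneousSubmodule (Fin n) K 1
  eventually_const : ∃ N : ℕ, ∀ i, ∀ j > N, L i j = L i N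

/-- The distraction operator: the linear map that sends the power product with exponents `α` to
the product over all `i` of the first `α i` entries of the `i`-th row of `L`. -/
noncomputable def distraction {n : ℕ} {K : Type*} [Field K]
    (L : Fin n → ℕ → MvPolynomial (Fin n) K) :
    MvPolynomial (Fin n) K →ₗ[K] MvPolynomial (Fin n) K :=
  (basisMonomials (Fin n) K).constr K
    (fun α : Fin n →₀ ℕ => ∏ i, ∏ j ∈ Finset.range (α i), L i j)

theorem distraction_monomial {n : ℕ} {K : Type*} [Field K]
    (L : Fin n → ℕ → MvPolynomial (Fin n) K) (α : Fin n →₀ ℕ) :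
    distraction L (monomial α 1) = ∏ i, ∏ j ∈ Finset.range (α i), L i j := by
  have h := (basisMonomials (Fin n) K).constr_basis K
    (fun α : Fin n →₀ ℕ => ∏ i, ∏ j ∈ Finset.range (α i), L i j) α
  rwa [coe_basisMonomials] at h

/-- The distraction of an ideal `J`: the ideal generated by the image of `J` under the distraction
operator. For a monomial ideal and a distraction matrix it is that image
(see `coe_distractionIdeal`). -/
noncomputable def distractionIdeal {n : ℕ} {K : Type*} [Field K]
    (L : Fin n → ℕ → MvPolynomial (Fin n) K) (J : Ideal (MvPolynomial (Fin n) K)) :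
    Ideal (MvPolynomial (Fin n) K) :=
  Ideal.span (distraction L '' (J : Set (MvPolynomial (Fin n) K)))

theorem distraction_mul_X {n : ℕ} {K : Type*} [Field K]
    (L : Fin n → ℕ → MvPolynomial (Fin n) K) (α : Fin n →₀ ℕ) (k : Fin n) :
    distraction L (X k * monomial α 1) = L k (α k) * distraction L (monomial α 1) := by
  have h : (X k * monomial α 1 : MvPolynomial (Fin n) K) =
      monomial (Finsupp.single k 1 + α) 1 := by
    rw [X, monomial_mul, one_mul]
  rw [h, distraction_monomial, distraction_monomial,
    ← Finset.mul_prod_erase Finset.univ _ (Finset.mem_univ k),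
    ← Finset.mul_prod_erase Finset.univ (fun i => ∏ j ∈ Finset.range (α i), L i j)
      (Finset.mem_univ k), ← mul_assoc]
  congr 1
  · have : (Finsupp.single k 1 + α : Fin n →₀ ℕ) k = α k + 1 := by simp [add_comm]
    rw [this, Finset.prod_range_succ, mul_comm]
  · refine Finset.prod_congr rfl fun i hi => ?_
    have hik : i ≠ k := Finset.ne_of_mem_erase hi
    simp [hik.symm]

/-- The image of a monomial ideal under the distraction operator is an ideal. -/
theorem coe_distractionIdeal {n : ℕ} {K : Type*} [Field K]
    {L : Fin n → ℕ → MvPolynomial (Fin n) K} (hL : IsDistractionMatrix L)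
    {J : Ideal (MvPolynomial (Fin n) K)} (hJ : IsMonomialIdeal J) :
    (distractionIdeal L J : Set (MvPolynomial (Fin n) K)) =
      distraction L '' (J : Set (MvPolynomial (Fin n) K)) := by
  refine Set.Subset.antisymm ?_ Ideal.subset_span
  let V : Submodule K (MvPolynomial (Fin n) K) := (J.restrictScalars K).map (distraction L)
  have hX : ∀ (k : Fin n) (v : MvPolynomial (Fin n) K), v ∈ V → X k * v ∈ V := by
    obtain ⟨S, hS⟩ := hJ
    intro k v hv
    have hV : V = Submodule.span K (distraction L ''
        ((fun t => (monomial t 1 : MvPolynomial (Fin n) K)) '' S)) := by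
      simp only [V]
      rw [hS, Submodule.map_span]
    have hv' := hv
    rw [hV] at hv'
    induction hv' using Submodule.span_induction with
    | mem x hx =>
      obtain ⟨_, ⟨t, ht, rfl⟩, rfl⟩ := hx
      have htJ : (monomial t 1 : MvPolynomial (Fin n) K) ∈ J := by
        have : (monomial t 1 : MvPolynomial (Fin n) K) ∈ J.restrictScalars K := by
          rw [hS]
          exact Submodule.subset_span ⟨t, ht, rfl⟩
        exact this
      have hk : (X k : MvPolynomial (Fin n) K) ∈
          Submodule.span K (Set.range fun i => L i (t i)) := by
        rw [hL.span_eq (fun i => t i)]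
        exact isHomogeneous_X K k
      generalize (X k : MvPolynomial (Fin n) K) = ℓ at hk
      induction hk using Submodule.span_induction with
      | mem y hy =>
        obtain ⟨i, rfl⟩ := hy
        change L i (t i) * distraction L (monomial t 1) ∈ V
        rw [← distraction_mul_X]
        exact Submodule.mem_map_of_mem (J.mul_mem_left _ htJ)
      | zero => simp
      | add y z _ _ hy hz => rw [add_mul]; exact V.add_mem hy hz
      | smul c y _ hy => rw [smul_mul_assoc]; exact V.smul_mem c hy
    | zero => simp
    | add x y hx hy ihx ihy =>
      rw [mul_add]
      exact V.add_mem (ihx (hV ▸ hx)) (ihy (hV ▸ hy))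
    | smul c x hx ihx =>
      rw [mul_smul_comm]
      exact V.smul_mem c (ihx (hV ▸ hx))
  have hP : ∀ p v : MvPolynomial (Fin n) K, v ∈ V → p * v ∈ V := by
    intro p
    induction p using MvPolynomial.induction_on with
    | C c =>
      intro v hv
      rw [← smul_eq_C_mul]
      exact V.smul_mem c hv
    | add p q hp hq => intro v hv; rw [add_mul]; exact V.add_mem (hp v hv) (hq v hv)
    | mul_X p k hp => intro v hv; rw [mul_assoc]; exact hp _ (hX k v hv)
  intro x hx
  have hxV : x ∈ V := by
    induction (show x ∈ Ideal.span (distraction L '' (J : Set (MvPolynomial (Fin n) K)))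
      from hx) using Submodule.span_induction with
    | mem y hy => exact hy
    | zero => exact V.zero_mem
    | add y z hy' hz' hy hz => exact V.add_mem (hy hy') (hz hz')
    | smul p y hy' hy => exact hP p y (hy hy')
  exact hxV

/-! ### Monomial ideals -/

/-! The factor `F` and the distraction can be treated separately. The coefficient of `x_1^a` in `gF`
is `F` evaluated at the first row of `g`, so for generic `g` the leading power product of `gF` is
`x_1^a`. Leading power products multiply, so it remains to show that the initial ideal of
`g(D_L(J))` is `J`. Since `g(D_L(J)) = D_{gL}(J)`, this is a statement about a distraction matrix in
general position (`IsFlagGeneric`), a condition that amounts to finitely many minors being non-zero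
because the columns are eventually constant.

The heart is `monomial_mul_distraction_mem`. Starting from a power product in `J`, its
indeterminates are traded one by one, first index first, for linear forms of the matrix. General
position writes `x_i` through entries of the rows `j ≤ i`, modulo the `x_l` with `l > i`. The
entries lead to distractions of power products that strong stability keeps in `J`; the `x_l` lead to
terms that are smaller in the reverse lexicographic ordering. Hence each power product of `J` is a
leading one of `D_{gL}(J)`.

There are no others, by counting: for finitely many `t ∈ J`, the elements `D(t)` span a space of at
most that dimension, which is exhausted by elements with distinct leading power products
(`MonomialOrder.degree_mem_of_mem_span`). -/

theorem isMonomialIdeal_iff {n : ℕ} {K : Type*} [Field K]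
    {J : Ideal (MvPolynomial (Fin n) K)} : IsMonomialIdeal J ↔
      ∀ f ∈ J, ∀ t ∈ f.support, (monomial t 1 : MvPolynomial (Fin n) K) ∈ J := by
  constructor
  · rintro ⟨S, hS⟩ f hf t ht
    rw [← restrictSupport_eq_span] at hS
    have hfS : f ∈ J.restrictScalars K := hf
    rw [hS, mem_restrictSupport_iff] at hfS
    have : (monomial t 1 : MvPolynomial (Fin n) K) ∈ J.restrictScalars K := by
      rw [hS, monomial_mem_restrictSupport]
      exact Or.inl (hfS ht)
    exact this
  · intro h
    refine ⟨{t | (monomial t 1 : MvPolynomial (Fin n) K) ∈ J}, le_antisymm ?_ ?_⟩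
    · intro f hf
      rw [← restrictSupport_eq_span, mem_restrictSupport_iff]
      exact fun t ht => h f hf t ht
    · rw [Submodule.span_le]
      rintro _ ⟨t, ht, rfl⟩
      exact ht

theorem IsMonomialIdeal.eq_span {n : ℕ} {K : Type*} [Field K]
    {J : Ideal (MvPolynomial (Fin n) K)} (hJ : IsMonomialIdeal J) :
    J = Ideal.span {f | ∃ t, (monomial t 1 : MvPolynomial (Fin n) K) ∈ J ∧ f = monomial t 1} := by
  refine le_antisymm (fun f hf => ?_) (Ideal.span_le.2 ?_)
  · rw [f.as_sum]
    refine Ideal.sum_mem _ fun t ht => ?_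
    rw [show monomial t (coeff t f) = C (coeff t f) * monomial t 1 by
      rw [C_mul_monomial, mul_one]]
    exact Ideal.mul_mem_left _ _ (Ideal.subset_span ⟨t, isMonomialIdeal_iff.1 hJ f hf t ht, rfl⟩)
  · rintro _ ⟨t, ht, rfl⟩
    exact ht

/-- Divisibility of power products is well-founded, so each power product of `I` is a multiple of a
minimal one. -/
theorem IsMonomialIdeal.dvd_of_dvd_minimalGenerators {n : ℕ} {K : Type*} [Field K]
    {I : Ideal (MvPolynomial (Fin n) K)} (hI : IsMonomialIdeal I) {e : MvPolynomial (Fin n) K}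
    (he : ∀ s ∈ minimalGenerators I, e ∣ s) {f : MvPolynomial (Fin n) K} (hf : f ∈ I) :
    e ∣ f := by
  rw [hI.eq_span] at hf
  rw [← Ideal.mem_span_singleton]
  refine Ideal.span_le.2 ?_ hf
  rintro _ ⟨t, ht, rfl⟩
  obtain ⟨s, hst, hs⟩ := exists_minimal_le_of_wellFoundedLT
    (fun s => (monomial s 1 : MvPolynomial (Fin n) K) ∈ I) t ht
  refine Ideal.mem_span_singleton.2 ((he _ ⟨s, hs, rfl⟩).trans ?_)
  rw [monomial_dvd_monomial]
  exact ⟨Or.inr hst, dvd_rfl⟩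

theorem mul_mem_span_singleton_mul_iff {R : Type*} [CommRing R] [IsDomain R] {e z : R}
    (he : e ≠ 0) {J : Ideal R} : e * z ∈ Ideal.span {e} * J ↔ z ∈ J := by
  rw [Ideal.mem_span_singleton_mul]
  exact ⟨fun ⟨w, hw, h⟩ => mul_left_cancel₀ he h ▸ hw, fun h => ⟨z, h, rfl⟩⟩

theorem exists_eq_span_singleton_mul {R : Type*} [CommRing R] {e : R} {I : Ideal R}
    (h : ∀ f ∈ I, e ∣ f) : ∃ J : Ideal R, I = Ideal.span {e} * J := by
  -- The cofactor is the set of all `z` with `e * z ∈ I`.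
  refine ⟨Submodule.comap (LinearMap.mulLeft R e) I, Ideal.ext fun f => ?_⟩
  rw [Ideal.mem_span_singleton_mul]
  constructor
  · intro hf
    obtain ⟨z, rfl⟩ := h f hf
    exact ⟨z, hf, rfl⟩
  · rintro ⟨z, hz, rfl⟩
    exact hz

/-- An exchange of `x_j` for `x_i` in `t` is also one in `x^b t` that leaves the factor `x^b` alone,
and this factor can be cancelled. -/
theorem IsStronglyStable.of_monomial_mul {n : ℕ} {K : Type*} [Field K]
    {J : Ideal (MvPolynomial (Fin n) K)} (b : Fin n →₀ ℕ)
    (h : IsStronglyStable (Ideal.span {monomial b 1} * J)) : IsStronglyStable J := by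
  have hb : (monomial b 1 : MvPolynomial (Fin n) K) ≠ 0 := by simp
  have key : ∀ t, (monomial (b + t) 1 : MvPolynomial (Fin n) K) ∈
      Ideal.span {monomial b 1} * J ↔ (monomial t 1 : MvPolynomial (Fin n) K) ∈ J := by
    intro t
    rw [← mul_mem_span_singleton_mul_iff hb (z := monomial t 1), monomial_mul, one_mul]
  refine ⟨isMonomialIdeal_iff.2 fun f hf t ht => ?_, fun t ht i j hj hij => ?_⟩
  · rw [← key]
    refine isMonomialIdeal_iff.1 h.1 _ ((mul_mem_span_singleton_mul_iff hb).2 hf) _ ?_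
    rw [mem_support_iff, coeff_monomial_mul, one_mul]
    exact mem_support_iff.1 ht
  · rw [← key] at ht ⊢
    have := h.2 _ ht i j (by rw [Finsupp.add_apply]; omega) hij
    convert this using 2
    rw [add_tsub_assoc_of_le (Finsupp.single_le_iff.2 hj), add_left_comm]

/-! ### Leading power products of linear combinations -/

/-- The largest `t` with `c t ≠ 0` cannot cancel, because the leading power products of the summands
are distinct. -/
theorem MonomialOrder.degree_sum_smul_mem {σ K : Type*} [Field K] (m : MonomialOrder σ)
    {T : Finset (σ →₀ ℕ)} {f : (σ →₀ ℕ) → MvPolynomial σ K}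
    (hf : ∀ t ∈ T, m.degree (f t) = t) (hf0 : ∀ t ∈ T, f t ≠ 0) {c : (σ →₀ ℕ) → K}
    (hc : ∃ t ∈ T, c t ≠ 0) :
    ∑ t ∈ T, c t • f t ≠ 0 ∧ m.degree (∑ t ∈ T, c t • f t) ∈ T := by
  classical
  have hne : (T.filter fun t => c t ≠ 0).Nonempty := by
    obtain ⟨t, ht, h⟩ := hc
    exact ⟨t, Finset.mem_filter.2 ⟨ht, h⟩⟩
  obtain ⟨t₀, ht₀, hmax⟩ := Finset.exists_max_image _ m.toSyn hne
  obtain ⟨ht₀T, hct₀⟩ := Finset.mem_filter.1 ht₀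
  have hcoeff : coeff t₀ (∑ t ∈ T, c t • f t) = c t₀ * coeff t₀ (f t₀) := by
    rw [coeff_sum, Finset.sum_eq_single_of_mem t₀ ht₀T]
    · rw [coeff_smul, smul_eq_mul]
    · intro t ht hne
      by_cases h0 : c t = 0
      · simp [h0]
      · have hlt : m.toSyn t < m.toSyn t₀ :=
          lt_of_le_of_ne (hmax t (Finset.mem_filter.2 ⟨ht, h0⟩))
            (fun h => hne (m.toSyn.injective h))
        rw [coeff_smul, m.coeff_eq_zero_of_lt (by rwa [hf t ht]), smul_zero]
  have hlc : coeff t₀ (f t₀) ≠ 0 := by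
    have := (m.coeff_degree_ne_zero_iff (f := f t₀)).2 (hf0 t₀ ht₀T)
    rwa [hf t₀ ht₀T] at this
  have hsum : coeff t₀ (∑ t ∈ T, c t • f t) ≠ 0 := by
    rw [hcoeff]; exact mul_ne_zero hct₀ hlc
  refine ⟨fun h => hsum (by rw [h, coeff_zero]), ?_⟩
  have hdeg : m.degree (∑ t ∈ T, c t • f t) = t₀ := by
    apply m.toSyn.injective
    refine le_antisymm ?_ (m.le_degree (mem_support_iff.2 hsum))
    rw [m.degree_le_iff]
    intro s hs
    by_contra hlt
    rw [not_le] at hlt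
    refine mem_support_iff.1 hs ?_
    rw [coeff_sum]
    refine Finset.sum_eq_zero fun t ht => ?_
    by_cases h0 : c t = 0
    · simp [h0]
    · rw [coeff_smul, m.coeff_eq_zero_of_lt, smul_zero]
      rw [hf t ht]
      exact (hmax t (Finset.mem_filter.2 ⟨ht, h0⟩)).trans_lt hlt
  rw [hdeg]
  exact ht₀T

/-- If a space spanned by a family indexed by a finite set `T` of power products contains for
each `t ∈ T` an element with leading power product `t`, then all leading power products of
its elements lie in `T`. -/
theorem MonomialOrder.degree_mem_of_mem_span {σ K : Type*} [Field K] (m : MonomialOrder σ)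
    {T : Finset (σ →₀ ℕ)} {b f : (σ →₀ ℕ) → MvPolynomial σ K}
    (hfb : ∀ t ∈ T, f t ∈ Submodule.span K (b '' T))
    (hf : ∀ t ∈ T, m.degree (f t) = t) (hf0 : ∀ t ∈ T, f t ≠ 0) {g : MvPolynomial σ K}
    (hg : g ∈ Submodule.span K (b '' T)) (hg0 : g ≠ 0) : m.degree g ∈ T := by
  classical
  have hext : ∀ c : T → K, ∃ c' : (σ →₀ ℕ) → K, (∀ t : T, c' t = c t) ∧
      ∑ t : T, c t • f t = ∑ t ∈ T, c' t • f t := by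
    intro c
    have hc' : ∀ t : T, (fun t => if h : t ∈ T then c ⟨t, h⟩ else 0) t.1 = c t := by simp
    refine ⟨fun t => if h : t ∈ T then c ⟨t, h⟩ else 0, hc', ?_⟩
    rw [← Finset.sum_coe_sort T]
    exact Finset.sum_congr rfl fun t _ => by rw [hc' t]
  have hli : LinearIndependent K (fun t : T => f t) := by
    rw [Fintype.linearIndependent_iff]
    intro c hc
    obtain ⟨c', hc', hsum⟩ := hext c
    by_contra! hcon
    obtain ⟨t, ht⟩ := hcon
    exact (m.degree_sum_smul_mem hf hf0 ⟨t, t.2, by rwa [hc']⟩).1 (hsum ▸ hc)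
  have hle : Submodule.span K (Set.range fun t : T => f t) ≤ Submodule.span K (b '' T) := by
    rw [Submodule.span_le]
    rintro _ ⟨t, rfl⟩
    exact hfb t t.2
  have : FiniteDimensional K (Submodule.span K (b '' T)) :=
    FiniteDimensional.span_of_finite K (T.finite_toSet.image b)
  -- The independent `f t` number `|T|`, and the ambient span has at most `|T|` generators, so the
  -- two spaces agree.
  have heq := Submodule.eq_of_le_of_finrank_le hle (by
    rw [finrank_span_eq_card hli, Fintype.card_coe, ← Finset.coe_image]
    exact (finrank_span_finset_le_card _).trans Finset.card_image_le)
  rw [← heq, Submodule.mem_span_range_iff_exists_fun] at hg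
  obtain ⟨c, rfl⟩ := hg
  obtain ⟨c', hc', hsum⟩ := hext c
  rw [hsum] at hg0 ⊢
  refine (m.degree_sum_smul_mem hf hf0 ?_).2
  by_contra! hcon
  exact hg0 (Finset.sum_eq_zero fun t ht => by rw [hcon t ht, zero_smul])

/-! ### Distractions in general coordinates -/

/-- The linear forms `L i j` are in general position with respect to the flag of the spaces
`⟨x_l | l > i⟩`: modulo this space, each choice of entries from the rows up to `i` generates
`x_i`. -/
def IsFlagGeneric {n : ℕ} {K : Type*} [Field K] (L : Fin n → ℕ → MvPolynomial (Fin n) K) : Prop :=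
  ∀ (i : Fin n) (c : Fin n → ℕ), ∃ y z : Fin n → K,
    X i = ∑ j ∈ Finset.Iic i, y j • L j (c j) + ∑ l ∈ Finset.Ioi i, z l • X l

theorem isHomogeneous_distraction_monomial {n : ℕ} {K : Type*} [Field K]
    {L : Fin n → ℕ → MvPolynomial (Fin n) K} (hL : ∀ i j, (L i j).IsHomogeneous 1)
    (u : Fin n →₀ ℕ) : (distraction L (monomial u 1)).IsHomogeneous u.degree := by
  rw [distraction_monomial, Finsupp.degree_eq_sum]
  refine IsHomogeneous.prod _ _ _ fun i _ => ?_
  have := IsHomogeneous.prod (Finset.range (u i)) (fun j => L i j) (fun _ => 1)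
    fun j _ => hL i j
  simpa using this

/-- The power products of degree `d` that have a larger exponent than `v` in the last
indeterminate in which they differ from `v`, where this indeterminate comes after `x_i`. -/
def revLexBelow {n : ℕ} (i : Fin n) (v : Fin n →₀ ℕ) (d : ℕ) : Set (Fin n →₀ ℕ) :=
  {s | s.degree = d ∧ ∃ l, i < l ∧ v l < s l ∧ ∀ k, l < k → s k = v k}

theorem revLexBelow_of_le {n : ℕ} {i l : Fin n} (hil : i < l) {v s : Fin n →₀ ℕ} {d : ℕ}
    (hd : s.degree = d) (h : v + Finsupp.single l 1 ≤ s) : s ∈ revLexBelow i v d := by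
  classical
  have hl : v l < s l := by
    have := h l
    rw [Finsupp.add_apply, Finsupp.single_eq_same] at this
    omega
  have hne : (Finset.univ.filter fun k => v k < s k).Nonempty := ⟨l, by simpa using hl⟩
  -- The witness is the last index at which `s` exceeds `v`; it is at least `l`, and `v ≤ s` forces
  -- equality beyond it.
  refine ⟨hd, (Finset.univ.filter fun k => v k < s k).max' hne,
    hil.trans_le (Finset.le_max' _ _ (by simpa using hl)), ?_, fun k hk => ?_⟩
  · simpa using Finset.max'_mem _ hne
  · by_contra hcon
    have hvs : v k < s k := by
      have := h k
      rw [Finsupp.add_apply] at this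
      omega
    exact absurd hk (not_lt.2 (Finset.le_max' _ _ (by simpa using hvs)))

/-- The product `x^v * D(x^u)` is an intermediate stage of the trade: `u` records what has been
turned into linear forms, `v` what is still to be treated. The case `u = 0` is the one that is
wanted; the induction on the degree of `v` needs arbitrary `u` and a moving index `i` that separates
the two supports. -/
theorem monomial_mul_distraction_mem {n : ℕ} {K : Type*} [Field K]
    {L : Fin n → ℕ → MvPolynomial (Fin n) K} (hL : ∀ i j, (L i j).IsHomogeneous 1)
    (hgen : IsFlagGeneric L) {J : Ideal (MvPolynomial (Fin n) K)} (hJ : IsStronglyStable J)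
    (v : Fin n →₀ ℕ) : ∀ (i : Fin n) (u : Fin n →₀ ℕ), (∀ l, i < l → u l = 0) →
      (∀ l, l < i → v l = 0) → (monomial (u + v) 1 : MvPolynomial (Fin n) K) ∈ J →
      monomial v 1 * distraction L (monomial u 1) ∈
        Submodule.span K ((fun t => distraction L (monomial t 1)) ''
          {t | (monomial t 1 : MvPolynomial (Fin n) K) ∈ J ∧ t.degree = (u + v).degree}) ⊔
        restrictSupport K (revLexBelow i v (u + v).degree) := by
  classical
  induction hk : v.degree generalizing v with
  | zero =>
    intro i u hu hv huv
    rw [Finsupp.degree_eq_zero_iff] at hk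
    subst hk
    refine Submodule.mem_sup_left (Submodule.subset_span ⟨u, ⟨by simpa using huv, by simp⟩, ?_⟩)
    change _ = 1 * _
    rw [one_mul]
  | succ k ih =>
    intro i u hu hv huv
    have hne : v.support.Nonempty := by
      rw [Finsupp.support_nonempty_iff]
      rintro rfl
      simp at hk
    obtain ⟨i', hi'⟩ : ∃ i', i' = v.support.min' hne := ⟨_, rfl⟩
    have hi'v : 0 < v i' := by
      have := Finset.min'_mem _ hne
      rw [← hi', Finsupp.mem_support_iff] at this
      exact Nat.pos_of_ne_zero this
    have hmin : ∀ l, l < i' → v l = 0 := by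
      intro l hl
      by_contra h
      exact absurd hl (not_lt.2 (hi' ▸ Finset.min'_le _ _ (Finsupp.mem_support_iff.2 h)))
    have hii' : i ≤ i' := by
      by_contra h
      exact hi'v.ne' (hv i' (not_le.1 h))
    obtain ⟨v', hv'⟩ := exists_add_of_le (Finsupp.single_le_iff.2 (Nat.succ_le_of_lt hi'v))
    have hv'_lt : ∀ l, l < i' → v' l = 0 := by
      intro l hl
      have := hmin l hl
      rw [hv', Finsupp.add_apply] at this
      omega
    have hv'_gt : ∀ l, i' < l → v l = v' l := by
      intro l hl
      rw [hv', Finsupp.add_apply, Finsupp.single_eq_of_ne hl.ne', zero_add]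
    have hv'deg : v'.degree = k := by
      rw [hv', map_add, Finsupp.degree_single] at hk
      omega
    -- Error terms below `v'` are also below `v`, since the two exponent vectors agree after `i'`
    -- and only those indices matter.
    have hmono : restrictSupport K (revLexBelow i' v' (u + v).degree) ≤
        restrictSupport K (revLexBelow i v (u + v).degree) := by
      refine restrictSupport_mono _ ?_
      rintro s ⟨hs, l, hl, hlt, hgt⟩
      refine ⟨hs, l, hii'.trans_lt hl, by rwa [hv'_gt l hl], fun k hk => ?_⟩
      rw [hgt k hk, hv'_gt k (hl.trans hk)]
    refine sup_le_sup_left hmono _ ?_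
    -- Taking the exponents of `u` as column indices makes each entry the next factor of the
    -- distraction: `L j (u j) * D(x^u) = D(x_j x^u)`.
    obtain ⟨y, z, hyz⟩ := hgen i' u
    have hexp : (monomial v 1 : MvPolynomial (Fin n) K) * distraction L (monomial u 1) =
        ∑ j ∈ Finset.Iic i', y j • (monomial v' 1 *
          distraction L (monomial (Finsupp.single j 1 + u) 1)) +
        ∑ l ∈ Finset.Ioi i', z l • (monomial (v' + Finsupp.single l 1) 1 *
          distraction L (monomial u 1)) := by
      have h1 : (monomial v 1 : MvPolynomial (Fin n) K) = monomial v' 1 * X i' := by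
        rw [hv', X, monomial_mul, one_mul, add_comm]
      rw [h1, hyz, mul_add, add_mul, Finset.mul_sum, Finset.mul_sum, Finset.sum_mul,
        Finset.sum_mul]
      congr 1
      · refine Finset.sum_congr rfl fun j _ => ?_
        have h2 : (monomial (Finsupp.single j 1 + u) 1 : MvPolynomial (Fin n) K) =
            X j * monomial u 1 := by rw [X, monomial_mul, one_mul]
        rw [h2, distraction_mul_X, mul_smul_comm, smul_mul_assoc, mul_assoc]
      · refine Finset.sum_congr rfl fun l _ => ?_
        have h2 : (monomial (v' + Finsupp.single l 1) 1 : MvPolynomial (Fin n) K) =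
            monomial v' 1 * X l := by rw [X, monomial_mul, one_mul]
        rw [h2, mul_smul_comm, smul_mul_assoc]
    rw [hexp]
    refine Submodule.add_mem _ (Submodule.sum_mem _ fun j hj => Submodule.smul_mem _ _ ?_)
      (Submodule.sum_mem _ fun l hl => Submodule.smul_mem _ _ (Submodule.mem_sup_right ?_))
    · rw [Finset.mem_Iic] at hj
      have hdeg : (Finsupp.single j 1 + u + v').degree = (u + v).degree := by
        rw [hv']
        simp only [map_add, Finsupp.degree_single]
        ring
      rw [← hdeg]
      refine ih v' hv'deg i' _ (fun l hl => ?_) hv'_lt ?_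
      · rw [Finsupp.add_apply, hu l (hii'.trans_lt hl),
          Finsupp.single_eq_of_ne (hj.trans_lt hl).ne']
      -- Trading `x_{i'}` for an entry of row `j ≤ i'` replaces `x_{i'}` by `x_j` in `x^(u+v)`,
      -- which is the exchange allowed by strong stability.
      · have := hJ.2 _ huv j i' (by rw [Finsupp.add_apply]; omega) hj
        convert this using 2
        rw [hv', add_left_comm u, add_tsub_cancel_left, add_assoc]
    · rw [Finset.mem_Ioi] at hl
      rw [mem_restrictSupport_iff]
      intro s hs
      have hle : v' + Finsupp.single l 1 ≤ s := by
        by_contra hcon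
        rw [Finset.mem_coe, mem_support_iff, coeff_monomial_mul', if_neg hcon] at hs
        exact hs rfl
      refine revLexBelow_of_le hl ?_ hle
      have hh := (isHomogeneous_monomial (1 : K) (n := k + 1) (d := v' + Finsupp.single l 1)
        (by rw [map_add, hv'deg, Finsupp.degree_single])).mul
        (isHomogeneous_distraction_monomial hL u)
      have := hh (mem_support_iff.1 hs)
      rw [map_add, hk, add_comm, ← this]
      exact DFunLike.congr_fun Finsupp.degree_eq_weight_one s

/-- Every power product in a strongly stable ideal is a leading power product of its distraction
in general coordinates. -/
theorem exists_mem_span_distraction_degree_eq {n : ℕ} {K : Type*} [Field K]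
    {L : Fin n → ℕ → MvPolynomial (Fin n) K} (hL : ∀ i j, (L i j).IsHomogeneous 1)
    (hgen : IsFlagGeneric L) {J : Ideal (MvPolynomial (Fin n) K)} (hJ : IsStronglyStable J)
    {v : Fin n →₀ ℕ} (hv : (monomial v 1 : MvPolynomial (Fin n) K) ∈ J) :
    ∃ f ∈ Submodule.span K ((fun t => distraction L (monomial t 1)) ''
        {t | (monomial t 1 : MvPolynomial (Fin n) K) ∈ J ∧ t.degree = v.degree}),
      f ≠ 0 ∧ (degRevLex n).degree f = v := by
  classical
  -- Without indeterminates there is no index to start the trade from, and `1` is the only power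
  -- product.
  rcases Nat.eq_zero_or_pos n with rfl | hn
  · obtain rfl : v = 0 := Subsingleton.elim _ _
    refine ⟨distraction L (monomial 0 1), Submodule.subset_span ⟨0, ⟨hv, rfl⟩, rfl⟩, ?_,
      Subsingleton.elim _ _⟩
    rw [distraction_monomial]
    simp
  have hmem := monomial_mul_distraction_mem hL hgen hJ v ⟨0, hn⟩ 0 (by simp)
    (fun l hl => absurd hl (not_lt.2 (Fin.le_def.2 (Nat.zero_le _)))) (by rwa [zero_add])
  rw [zero_add] at hmem
  have h1 : distraction L (monomial 0 1) = 1 := by rw [distraction_monomial]; simp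
  rw [h1, mul_one] at hmem
  obtain ⟨f, hf, e, he, hfe⟩ := Submodule.mem_sup.1 hmem
  rw [mem_restrictSupport_iff] at he
  have hlt : ∀ s ∈ e.support, s ≺[degRevLex n] v := by
    intro s hs
    obtain ⟨hd, l, -, hl, hgt⟩ := he hs
    exact (degRevLex_lt_iff s v).2 (Or.inr ⟨hd, l, hl, hgt⟩)
  have hf' : f = monomial v 1 - e := by rw [← hfe, add_sub_cancel_right]
  have hve : coeff v e = 0 := by
    by_contra h
    exact lt_irrefl _ (hlt v (mem_support_iff.2 h))
  have hvf : coeff v f = 1 := by rw [hf', coeff_sub, coeff_monomial, if_pos rfl, hve, sub_zero]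
  refine ⟨f, hf, fun h => by simp [h] at hvf, (degRevLex n).toSyn.injective (le_antisymm ?_ ?_)⟩
  · rw [MonomialOrder.degree_le_iff]
    intro s hs
    by_cases hsv : v = s
    · rw [hsv]
    · refine (hlt s ?_).le
      rw [mem_support_iff, hf', coeff_sub, coeff_monomial, if_neg hsv, zero_sub] at hs
      rw [mem_support_iff]
      exact fun h => hs (by rw [h, neg_zero])
  · exact (degRevLex n).le_degree (by rw [mem_support_iff, hvf]; exact one_ne_zero)

/-- The chosen entries generate every `x_i` by descending induction on `i`, since general position
reduces `x_i` to the entries and to later indeterminates. -/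
theorem IsFlagGeneric.isDistractionMatrix {n : ℕ} {K : Type*} [Field K]
    {L : Fin n → ℕ → MvPolynomial (Fin n) K} (hgen : IsFlagGeneric L)
    (hL : ∀ i j, (L i j).IsHomogeneous 1) (hconst : ∃ N : ℕ, ∀ i, ∀ j > N, L i j = L i N) :
    IsDistractionMatrix L := by
  refine ⟨hL, fun c => le_antisymm ?_ ?_, hconst⟩
  · rw [Submodule.span_le]
    rintro _ ⟨i, rfl⟩
    exact hL i _
  · rw [homogeneousSubmodule_one_eq_span_X, Submodule.span_le]
    rintro _ ⟨i, rfl⟩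
    induction i using WellFoundedGT.induction with
    | ind i ih =>
      obtain ⟨y, z, h⟩ := hgen i c
      rw [h]
      exact Submodule.add_mem _
        (Submodule.sum_mem _ fun j _ => Submodule.smul_mem _ _ (Submodule.subset_span ⟨j, rfl⟩))
        (Submodule.sum_mem _ fun l hl => Submodule.smul_mem _ _ (ih l (Finset.mem_Ioi.1 hl)))

/-- The initial ideal of the distraction of a strongly stable ideal in general coordinates is the
ideal itself. -/
theorem initialIdeal_distractionIdeal {n : ℕ} {K : Type*} [Field K]
    {L : Fin n → ℕ → MvPolynomial (Fin n) K} (hL : IsDistractionMatrix L)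
    (hgen : IsFlagGeneric L) {J : Ideal (MvPolynomial (Fin n) K)} (hJ : IsStronglyStable J) :
    initialIdeal (degRevLex n) (distractionIdeal L J) = J := by
  classical
  have hex := fun (v : Fin n →₀ ℕ) (hv : (monomial v 1 : MvPolynomial (Fin n) K) ∈ J) =>
    exists_mem_span_distraction_degree_eq hL.linear hgen hJ hv
  choose! f hfmem hf0 hfdeg using hex
  refine le_antisymm (Ideal.span_le.2 ?_) ?_
  · rintro _ ⟨q, hq, hq0, rfl⟩
    have hq' : q ∈ (distractionIdeal L J : Set (MvPolynomial (Fin n) K)) := hq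
    rw [coe_distractionIdeal hL hJ.1] at hq'
    obtain ⟨h, hh, rfl⟩ := hq'
    -- Bounding the degree by that of the preimage `h` makes the counting finite. The elements `f t`
    -- stay within the bound because they combine distractions of power products of the same degree
    -- as `t`.
    have hfin : {t : Fin n →₀ ℕ | (monomial t 1 : MvPolynomial (Fin n) K) ∈ J ∧
        t.degree ≤ h.totalDegree}.Finite :=
      (Finsupp.finite_of_degree_le h.totalDegree).subset fun t ht => ht.2
    have hmem : ∀ t, t ∈ hfin.toFinset ↔ (monomial t 1 : MvPolynomial (Fin n) K) ∈ J ∧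
        t.degree ≤ h.totalDegree := fun t => hfin.mem_toFinset
    refine ((hmem _).1 ((degRevLex n).degree_mem_of_mem_span (T := hfin.toFinset)
      (b := fun t => distraction L (monomial t 1)) (f := f)
      (fun t ht => ?_) (fun t ht => hfdeg t ((hmem t).1 ht).1)
      (fun t ht => hf0 t ((hmem t).1 ht).1) ?_ hq0)).1
    · refine Submodule.span_mono (Set.image_mono fun s hs => ?_) (hfmem t ((hmem t).1 ht).1)
      exact (hmem s).2 ⟨hs.1, hs.2 ▸ ((hmem t).1 ht).2⟩
    · generalize hfin.toFinset = T at hmem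
      rw [h.as_sum, map_sum]
      refine Submodule.sum_mem _ fun t ht => ?_
      rw [show monomial t (coeff t h) = coeff t h • monomial t 1 by
        rw [smul_monomial, smul_eq_mul, mul_one], map_smul]
      refine Submodule.smul_mem _ _ (Submodule.subset_span ⟨t, ?_, rfl⟩)
      exact (hmem t).2 ⟨isMonomialIdeal_iff.1 hJ.1 h hh t ht, le_totalDegree ht⟩
  · conv_lhs => rw [hJ.1.eq_span]
    refine Ideal.span_le.2 ?_
    rintro _ ⟨t, ht, rfl⟩
    refine Ideal.subset_span ⟨f t, ?_, hf0 t ht, by rw [hfdeg t ht]⟩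
    have : Submodule.span K ((fun s => distraction L (monomial s 1)) ''
        {s | (monomial s 1 : MvPolynomial (Fin n) K) ∈ J ∧ s.degree = t.degree}) ≤
        (distractionIdeal L J).restrictScalars K := by
      rw [Submodule.span_le]
      rintro _ ⟨s, hs, rfl⟩
      exact Ideal.subset_span ⟨_, hs.1, rfl⟩
    exact this (hfmem t ht)

/-! ### Generic changes of coordinates -/

theorem MvPolynomial.IsHomogeneous.eq_sum_smul_X {n : ℕ} {K : Type*} [Field K]
    {ℓ : MvPolynomial (Fin n) K} (h : ℓ.IsHomogeneous 1) :
    ∃ a : Fin n → K, ℓ = ∑ k, a k • X k := by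
  have : ℓ ∈ homogeneousSubmodule (Fin n) K 1 := h
  rw [homogeneousSubmodule_one_eq_span_X, Submodule.mem_span_range_iff_exists_fun] at this
  obtain ⟨a, ha⟩ := this
  exact ⟨a, ha.symm⟩

theorem isHomogeneous_coordChange {n : ℕ} {K : Type*} [Field K] (g : Matrix (Fin n) (Fin n) K)
    {f : MvPolynomial (Fin n) K} {d : ℕ} (hf : f.IsHomogeneous d) :
    (coordChange g f).IsHomogeneous d := by
  have := hf.aeval (n := 1) (fun j => ∑ i, C (g i j) * (X i : MvPolynomial (Fin n) K))
    (fun j => IsHomogeneous.sum _ _ _ fun i _ => isHomogeneous_C_mul_X _ _)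
  rwa [one_mul] at this

theorem coordChange_sum_smul_X {n : ℕ} {K : Type*} [Field K] (g : Matrix (Fin n) (Fin n) K)
    (A : Matrix (Fin n) (Fin n) K) (j : Fin n) :
    coordChange g (∑ k, A j k • X k) = ∑ l, (A * g.transpose) j l • X l := by
  simp only [map_sum, map_smul, coordChange, aeval_X, Matrix.mul_apply, Matrix.transpose_apply,
    Finset.smul_sum, Finset.sum_smul, ← smul_eq_C_mul, smul_smul]
  exact Finset.sum_comm

/-- The invertible leading block yields a combination of the rows up to `i` whose coefficients in
the columns up to `i` are those of `x_i`; `z` then cancels the remaining columns. -/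
theorem exists_eq_sum_of_minor_ne_zero {n : ℕ} {K : Type*} [Field K]
    (M : Matrix (Fin n) (Fin n) K) (i : Fin n)
    (hdet : (M.submatrix (Subtype.val : {j // j ≤ i} → Fin n) Subtype.val).det ≠ 0) :
    ∃ y z : Fin n → K, (X i : MvPolynomial (Fin n) K) =
      ∑ j ∈ Finset.Iic i, y j • ∑ l, M j l • X l + ∑ l ∈ Finset.Ioi i, z l • X l := by
  classical
  set S := M.submatrix (Subtype.val : {j // j ≤ i} → Fin n) Subtype.val with hS
  let y' : {j // j ≤ i} → K := Matrix.vecMul (Pi.single ⟨i, le_rfl⟩ 1) S⁻¹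
  have hy' : Matrix.vecMul y' S = Pi.single ⟨i, le_rfl⟩ 1 := by
    rw [Matrix.vecMul_vecMul, Matrix.nonsing_inv_mul _ (Ne.isUnit hdet), Matrix.vecMul_one]
  let y : Fin n → K := fun j => if h : j ≤ i then y' ⟨j, h⟩ else 0
  have hy : ∀ l, l ≤ i → ∑ j ∈ Finset.Iic i, y j * M j l = if l = i then 1 else 0 := by
    intro l hl
    have h1 := congrFun hy' ⟨l, hl⟩
    rw [Matrix.vecMul, dotProduct] at h1
    rw [Finset.sum_subtype (Finset.Iic i) (p := fun j => j ≤ i) (fun j => Finset.mem_Iic)]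
    refine Eq.trans (Finset.sum_congr rfl fun j _ => ?_) (h1.trans ?_)
    · simp only [y, dif_pos j.2]
      rfl
    · simp [Pi.single_apply]
  refine ⟨y, fun l => -∑ j ∈ Finset.Iic i, y j * M j l, ?_⟩
  have h2 : ∑ j ∈ Finset.Iic i, y j • ∑ l, M j l • (X l : MvPolynomial (Fin n) K) =
      ∑ l, (∑ j ∈ Finset.Iic i, y j * M j l) • X l := by
    simp only [Finset.smul_sum, smul_smul, Finset.sum_smul]
    exact Finset.sum_comm
  have h3 : Disjoint (Finset.Iic i) (Finset.Ioi i) := by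
    rw [Finset.disjoint_left]
    intro l hl hl'
    exact absurd (Finset.mem_Ioi.1 hl') (not_lt.2 (Finset.mem_Iic.1 hl))
  have h4 : (Finset.univ : Finset (Fin n)) = Finset.Iic i ∪ Finset.Ioi i := by
    ext l
    simpa using le_or_gt l i
  rw [h2, h4, Finset.sum_union h3, add_assoc, ← Finset.sum_add_distrib,
    Finset.sum_eq_zero (s := Finset.Ioi i) (fun l _ => by rw [neg_smul, add_neg_cancel]),
    add_zero, Finset.sum_eq_single_of_mem i (Finset.mem_Iic.2 le_rfl), hy i le_rfl, if_pos rfl,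
    one_smul]
  intro l hl hli
  rw [hy l (Finset.mem_Iic.1 hl), if_neg hli, zero_smul]

/-- The leading principal minor of `A * gᵀ` with last index `i`, as a polynomial in the
entries of `g`. -/
noncomputable def leadingMinor {n : ℕ} {K : Type*} [Field K] (A : Matrix (Fin n) (Fin n) K)
    (i : Fin n) : MvPolynomial (Fin n × Fin n) K :=
  ((A.map C * (Matrix.mvPolynomialX (Fin n) (Fin n) K).transpose).submatrix
    (Subtype.val : {j // j ≤ i} → Fin n) Subtype.val).det

theorem eval_leadingMinor {n : ℕ} {K : Type*} [Field K] (A g : Matrix (Fin n) (Fin n) K)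
    (i : Fin n) : eval (fun ij => g ij.1 ij.2) (leadingMinor A i) =
      ((A * g.transpose).submatrix (Subtype.val : {j // j ≤ i} → Fin n) Subtype.val).det := by
  rw [leadingMinor, RingHom.map_det]
  congr 1
  ext j k
  simp [Matrix.mul_apply, Matrix.mvPolynomialX]

/-- At `g = Bᵀ` the matrix `A * gᵀ` is the identity, so the minor takes the value `1`. -/
theorem leadingMinor_ne_zero {n : ℕ} {K : Type*} [Field K] {A B : Matrix (Fin n) (Fin n) K}
    (h : A * B = 1) (i : Fin n) : leadingMinor A i ≠ 0 := by
  intro h0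
  have := eval_leadingMinor A B.transpose i
  rw [h0, map_zero, Matrix.transpose_transpose, h,
    Matrix.submatrix_one _ Subtype.val_injective, Matrix.det_one] at this
  exact zero_ne_one this

theorem IsDistractionMatrix.exists_mul_eq_one {n : ℕ} {K : Type*} [Field K]
    {L : Fin n → ℕ → MvPolynomial (Fin n) K} (hL : IsDistractionMatrix L) (c : Fin n → ℕ)
    {A : Matrix (Fin n) (Fin n) K} (hA : ∀ j, L j (c j) = ∑ k, A j k • X k) :
    ∃ B, A * B = 1 := by
  have hX : ∀ i, ∃ b : Fin n → K, ∑ j, b j • L j (c j) = X i := by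
    intro i
    rw [← Submodule.mem_span_range_iff_exists_fun, hL.span_eq]
    exact isHomogeneous_X K i
  choose B hB using hX
  refine ⟨Matrix.of B, mul_eq_one_comm.1 ?_⟩
  ext i k
  have h := congrArg (coeff (Finsupp.single k 1)) (hB i)
  simp only [hA, coeff_sum, coeff_smul, coeff_X, smul_eq_mul, Finsupp.single_left_inj one_ne_zero,
    mul_ite, mul_one, mul_zero, Finset.sum_ite_eq', Finset.mem_univ, if_true] at h
  rw [Matrix.mul_apply, Matrix.one_apply]
  simpa using h

/-- After a generic change of coordinates, a distraction matrix is in general position. -/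
theorem IsDistractionMatrix.exists_isFlagGeneric {n : ℕ} {K : Type*} [Field K]
    {L : Fin n → ℕ → MvPolynomial (Fin n) K} (hL : IsDistractionMatrix L) :
    ∃ p : MvPolynomial (Fin n × Fin n) K, p ≠ 0 ∧ ∀ g : Matrix (Fin n) (Fin n) K,
      eval (fun ij => g ij.1 ij.2) p ≠ 0 → IsFlagGeneric fun i j => coordChange g (L i j) := by
  obtain ⟨N, hN⟩ := hL.eventually_const
  choose A hA using fun i j => (hL.linear i j).eq_sum_smul_X
  let M : (Fin n → ℕ) → Matrix (Fin n) (Fin n) K := fun c => Matrix.of fun j => A j (c j)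
  have hM : ∀ c j, L j (c j) = ∑ k, M c j k • X k := fun c j => hA j (c j)
  -- Columns after `N` repeat column `N`, so choices among the columns `0, …, N` suffice and the
  -- product is finite.
  refine ⟨∏ i, ∏ c : Fin n → Fin (N + 1), leadingMinor (M fun j => c j) i, ?_, ?_⟩
  · refine Finset.prod_ne_zero_iff.2 fun i _ => Finset.prod_ne_zero_iff.2 fun c _ => ?_
    obtain ⟨B, hB⟩ := hL.exists_mul_eq_one (fun j => c j) (hM _)
    exact leadingMinor_ne_zero hB i
  · intro g hg i c
    rw [map_prod, Finset.prod_ne_zero_iff] at hg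
    have hg' := hg i (Finset.mem_univ i)
    let c' : Fin n → Fin (N + 1) := fun j => ⟨min (c j) N, by omega⟩
    have hc' : ∀ j, L j (c j) = L j (c' j) := by
      intro j
      change L j (c j) = L j (min (c j) N)
      rcases le_or_gt (c j) N with h | h
      · rw [min_eq_left h]
      · rw [min_eq_right h.le, hN j _ h]
    rw [map_prod, Finset.prod_ne_zero_iff] at hg'
    have hdet := hg' c' (Finset.mem_univ _)
    rw [eval_leadingMinor] at hdet
    obtain ⟨y, z, hyz⟩ := exists_eq_sum_of_minor_ne_zero _ i hdet
    refine ⟨y, z, hyz.trans ?_⟩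
    congr 1
    refine Finset.sum_congr rfl fun j _ => ?_
    change _ = y j • coordChange g (L j (c j))
    rw [hc', hM (fun j => c' j), coordChange_sum_smul_X]

/-- A change of coordinates is multiplicative, so it acts on a product of entries of `L` entry by
entry. -/
theorem map_coordChange_distractionIdeal {n : ℕ} {K : Type*} [Field K]
    (L : Fin n → ℕ → MvPolynomial (Fin n) K) (J : Ideal (MvPolynomial (Fin n) K))
    (g : Matrix (Fin n) (Fin n) K) :
    (distractionIdeal L J).map (coordChange g) =
      distractionIdeal (fun i j => coordChange g (L i j)) J := by
  have h : (coordChange g).toLinearMap ∘ₗ distraction L =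
      distraction fun i j => coordChange g (L i j) := by
    refine (basisMonomials (Fin n) K).ext fun t => ?_
    rw [coe_basisMonomials]
    change coordChange g (distraction L (monomial t 1)) = _
    rw [distraction_monomial, distraction_monomial]
    simp only [map_prod]
  rw [distractionIdeal, distractionIdeal, Ideal.map_span, ← h]
  congr 1
  ext q
  simp

/-! ### Multiplication by a form -/

theorem MonomialOrder.initialIdeal_span_singleton_mul {n : ℕ} {K : Type*} [Field K]
    (m : MonomialOrder (Fin n)) {f : MvPolynomial (Fin n) K} (hf : f ≠ 0)
    (Q : Ideal (MvPolynomial (Fin n) K)) :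
    initialIdeal m (Ideal.span {f} * Q) =
      Ideal.span {monomial (m.degree f) 1} * initialIdeal m Q := by
  rw [initialIdeal, initialIdeal, Ideal.span_mul_span']
  congr 1
  ext t
  rw [Set.singleton_mul]
  constructor
  · rintro ⟨q, hq, hq0, rfl⟩
    obtain ⟨r, hr, rfl⟩ := Ideal.mem_span_singleton_mul.1 hq
    have hr0 := right_ne_zero_of_mul hq0
    refine ⟨_, ⟨r, hr, hr0, rfl⟩, ?_⟩
    change monomial (m.degree f) (1 : K) * monomial (m.degree r) 1 = _
    rw [monomial_mul, one_mul, m.degree_mul hf hr0]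
  · rintro ⟨_, ⟨r, hr, hr0, rfl⟩, rfl⟩
    refine ⟨f * r, Ideal.mem_span_singleton_mul.2 ⟨r, hr, rfl⟩, mul_ne_zero hf hr0, ?_⟩
    change monomial (m.degree f) (1 : K) * monomial (m.degree r) 1 = _
    rw [monomial_mul, one_mul, m.degree_mul hf hr0]

theorem eval_coordChange {n : ℕ} {K : Type*} [Field K] (g : Matrix (Fin n) (Fin n) K)
    (x : Fin n → K) (f : MvPolynomial (Fin n) K) :
    eval x (coordChange g f) = eval (fun j => ∑ i, g i j * x i) f := by
  induction f using MvPolynomial.induction_on with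
  | C c => simp [coordChange]
  | add p q hp hq => rw [map_add, map_add, map_add, hp, hq]
  | mul_X p k hp => rw [map_mul, map_mul, map_mul, hp]; simp [coordChange]

/-- Every other power product of degree `a` contains some `x_k` with `k ≠ i` and vanishes at the
`i`-th unit vector. -/
theorem MvPolynomial.IsHomogeneous.coeff_single_eq_eval {n : ℕ} {K : Type*} [Field K]
    {f : MvPolynomial (Fin n) K} {a : ℕ} (hf : f.IsHomogeneous a) (i : Fin n) :
    coeff (Finsupp.single i a) f = eval (Pi.single i 1) f := by
  classical
  rw [eval_eq', Finset.sum_eq_single (Finsupp.single i a)]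
  · rw [Finset.prod_eq_one, mul_one]
    intro k _
    by_cases h : k = i
    · subst h; simp
    · simp [Finsupp.single_eq_of_ne h]
  · intro t ht hti
    obtain ⟨k, hk, hki⟩ : ∃ k, t k ≠ 0 ∧ k ≠ i := by
      by_contra! hcon
      refine hti ?_
      have hti' : t = Finsupp.single i (t i) := by
        ext k
        by_cases h : k = i
        · subst h; simp
        · rw [Finsupp.single_eq_of_ne h]
          by_contra hk
          exact h (hcon k hk)
      have hd := hf.degree_eq_sum_deg_support ht
      rw [← Finsupp.degree_apply, hti', Finsupp.degree_single] at hd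
      rw [hti', ← hd]
    rw [Finset.prod_eq_zero (Finset.mem_univ k) (by simp [hki, hk]), mul_zero]
  · intro h
    rw [notMem_support_iff.1 h, zero_mul]

theorem degRevLex_degree_of_coeff_single_ne_zero {n : ℕ} [NeZero n] {K : Type*} [Field K]
    {f : MvPolynomial (Fin n) K} {a : ℕ} (hf : f.IsHomogeneous a)
    (h : coeff (Finsupp.single 0 a) f ≠ 0) :
    (degRevLex n).degree f = Finsupp.single 0 a := by
  classical
  refine (degRevLex n).toSyn.injective (le_antisymm ?_
    ((degRevLex n).le_degree (mem_support_iff.2 h)))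
  rw [MonomialOrder.degree_le_iff]
  intro s hs
  have hd : s.degree = a := by
    rw [Finsupp.degree_apply]
    exact (hf.degree_eq_sum_deg_support hs).symm
  by_cases hcon : ∃ i, i ≠ 0 ∧ s i ≠ 0
  · obtain ⟨i, hi, hsi⟩ := hcon
    have hne : (s.support.erase 0).Nonempty :=
      ⟨i, Finset.mem_erase.2 ⟨hi, Finsupp.mem_support_iff.2 hsi⟩⟩
    have hmax := Finset.mem_erase.1 (Finset.max'_mem _ hne)
    refine le_of_lt ((degRevLex_lt_iff _ _).2 (Or.inr ⟨by rw [hd, Finsupp.degree_single],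
      (s.support.erase 0).max' hne, ?_, fun j hj => ?_⟩))
    · rw [Finsupp.single_eq_of_ne hmax.1]
      exact Nat.pos_of_ne_zero (Finsupp.mem_support_iff.1 hmax.2)
    · have hj0 : j ≠ 0 := ((Fin.zero_le _).trans_lt hj).ne'
      rw [Finsupp.single_eq_of_ne hj0]
      by_contra hsj
      exact absurd hj (not_lt.2 (Finset.le_max' _ _
        (Finset.mem_erase.2 ⟨hj0, Finsupp.mem_support_iff.2 hsj⟩)))
  · push Not at hcon
    have hs0 : s = Finsupp.single 0 (s 0) := by
      ext k
      by_cases hk : k = 0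
      · subst hk; simp
      · rw [Finsupp.single_eq_of_ne hk, hcon k hk]
    have : s 0 = a := by rw [← hd, hs0, Finsupp.degree_single]; simp
    rw [hs0, this]

theorem mainTheorem10 {n : ℕ} [NeZero n] {K : Type*} [Field K] [Infinite K]
    (I : Ideal (MvPolynomial (Fin n) K)) (hI : IsStronglyStable I)
    (a : ℕ) (ha : IsGCDOf ((X 0 : MvPolynomial (Fin n) K) ^ a) (minimalGenerators I)) :
    (∃ J : Ideal (MvPolynomial (Fin n) K), I = Ideal.span {X 0 ^ a} * J) ∧
    ∀ J : Ideal (MvPolynomial (Fin n) K), I = Ideal.span {X 0 ^ a} * J →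
      IsStronglyStable J ∧
      ∀ F : MvPolynomial (Fin n) K, F.IsHomogeneous a → F ≠ 0 →
      ∀ L : Fin n → ℕ → MvPolynomial (Fin n) K, IsDistractionMatrix L →
        IsGin (degRevLex n) (Ideal.span {F} * distractionIdeal L J) I := by
  refine ⟨exists_eq_span_singleton_mul fun f hf =>
    hI.1.dvd_of_dvd_minimalGenerators ((ha _).1 dvd_rfl) hf, fun J hIJ => ?_⟩
  have hJ : IsStronglyStable J := by
    rw [hIJ, X_pow_eq_monomial] at hI
    exact hI.of_monomial_mul
  refine ⟨hJ, fun F hF hF0 L hL => ?_⟩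
  obtain ⟨p, hp0, hp⟩ := hL.exists_isFlagGeneric
  have hinj : Function.Injective fun k : Fin n => ((0, k) : Fin n × Fin n) :=
    fun k l h => (Prod.mk.inj h).2
  -- The second factor is `F` in the entries of the first row of `g`; its value is the coefficient
  -- of `x_1^a` in `gF`.
  refine ⟨p * rename (fun k => (0, k)) F,
    mul_ne_zero hp0 ((map_ne_zero_iff _ (rename_injective _ hinj)).2 hF0), fun g hg => ?_⟩
  rw [map_mul] at hg
  have hgen := hp g.1 (left_ne_zero_of_mul hg)
  have hlin : ∀ i j, (coordChange g.1 (L i j)).IsHomogeneous 1 :=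
    fun i j => isHomogeneous_coordChange g.1 (hL.linear i j)
  have hL' := hgen.isDistractionMatrix hlin
    (hL.eventually_const.imp fun N h i j hj => congrArg (coordChange g.1) (h i j hj))
  have hgF := isHomogeneous_coordChange g.1 hF
  have hcoeff : coeff (Finsupp.single 0 a) (coordChange g.1 F) ≠ 0 := by
    have h := right_ne_zero_of_mul hg
    rw [eval_rename] at h
    rw [hgF.coeff_single_eq_eval, eval_coordChange]
    convert h using 3
    ext j
    simp [Pi.single_apply]
  have hgF0 : coordChange g.1 F ≠ 0 := fun h => hcoeff (by rw [h, coeff_zero])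
  rw [Ideal.map_mul, Ideal.map_span, Set.image_singleton, map_coordChange_distractionIdeal,
    MonomialOrder.initialIdeal_span_singleton_mul _ hgF0, initialIdeal_distractionIdeal hL' hgen hJ,
    degRevLex_degree_of_coeff_single_ne_zero hgF hcoeff, hIJ, X_pow_eq_monomial]
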